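/- Let $(d_0,d_1,d_2,\dots)$ be a sequence of integers with $d_i\ge 1$ for all $i$. Define words over $\{a,b\}$ by $s_{-1}=b$, $s_0=a$ and $s_{n+1}=s_n^{d_n}s_{n-1}$ for $n\ge 0$, let $q_i=|s_i|$, and let $w=\lim_{n\to\infty}s_n$ be the characteristic Sturmian word corresponding to the directive sequence $(d_i)$. Write $w(i..j]=w[i+1]w[i+2]\cdots w[j]$. For a non-negative integer $N$ and non-negative integers $k_0,\dots,k_n$, we say that $\overline{k_n\cdots k_0}$ is a valid representation of $N$ if $N=\sum_{0\le i\le n}k_iq_i$ and $w(0..N]=s_n^{k_n}s_{n-1}^{k_{n-1}}\cdots s_0^{k_0}$. Theorem. Let $0\le p_1\le p_2$ be such that $w(p_1..p_2]$ is a palindrome. Then there exist a valid representation $\overline{x_n\cdots x_0}$ of $p_1$, a number $m\le n$ and an integer $y_m\ge 0$ such that $x_i\le d_i$ for all $i<m$ and $$\overline{x_n\cdots x_{m+1}\,y_m\,(d_{m-1}-x_{m-1})\cdots(d_0-x_0)}$$ is a valid representation of $p_2$. -/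

import Mathlib

/-- The binary alphabet `{a, b}`. -/
inductive Letter : Type
  | a : Letter
  | b : Letter

/-- The power `u ^ k` of a finite word: the concatenation of `k` copies of `u`. -/
def wordPow (u : List Letter) (k : ℕ) : List Letter :=
  (List.replicate k u).flatten

/-- The standard words `s_n` (`n ≥ 0`) of the directive sequence `d`: `s_{-1} = b`, `s_0 = a` and
`s_{n+1} = s_n ^ (d_n) s_{n-1}` for `n ≥ 0`. The case `n = 0` of the recursion, which uses
`s_{-1} = b`, is the second line. -/
def standardWord (d : ℕ → ℕ) : ℕ → List Letter
  | 0 => [Letter.a]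
  | 1 => wordPow [Letter.a] (d 0) ++ [Letter.b]
  | n + 2 => wordPow (standardWord d (n + 1)) (d (n + 1)) ++ standardWord d n

/-- The characteristic word `w = lim s_n` of the directive sequence `d`. Letters are counted from
`0` here: `characteristicWord d i` is the letter `w[i + 1]`. When all `d_i ≥ 1` the word `s_i` has
more than `i` letters and is a prefix of `w` (see `factor_characteristicWord`), so the default value
is not used. -/
def characteristicWord (d : ℕ → ℕ) (i : ℕ) : Letter :=
  (standardWord d i).getD i Letter.a

/-- The factor `w(i..j] = w[i+1] w[i+2] ⋯ w[j]` of an infinite word, for `i ≤ j`. As letters are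
counted from `0`, these are the letters `w i, w (i + 1), …, w (j - 1)`. -/
def factor (w : ℕ → Letter) (i j : ℕ) : List Letter :=
  (List.range' i (j - i)).map w

/-- The word `s_n ^ (k_n) s_{n-1} ^ (k_{n-1}) ⋯ s_0 ^ (k_0)`. -/
def representationWord (d k : ℕ → ℕ) : ℕ → List Letter
  | 0 => wordPow (standardWord d 0) (k 0)
  | n + 1 => wordPow (standardWord d (n + 1)) (k (n + 1)) ++ representationWord d k n

/-- `k_n ⋯ k_1 k_0` is a valid representation of `N`: with `q_i = |s_i|` one has
`N = ∑_{0 ≤ i ≤ n} k_i q_i`, and the prefix `w(0..N]` of the characteristic word is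
`s_n ^ (k_n) ⋯ s_0 ^ (k_0)`. The values `k i` with `i > n` play no role. -/
structure IsValidRepresentation (d : ℕ → ℕ) (N n : ℕ) (k : ℕ → ℕ) : Prop where
  sum_eq : N = ∑ i ∈ Finset.range (n + 1), k i * (standardWord d i).length
  prefix_eq : factor (characteristicWord d) 0 N = representationWord d k n

theorem standardWord_prefix_succ {d : ℕ → ℕ} (hd : ∀ i, 1 ≤ d i) (n : ℕ) :
    standardWord d n <+: standardWord d (n + 1) := by
  have key : ∀ (u v : List Letter) (k : ℕ), 1 ≤ k → u <+: wordPow u k ++ v := by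
    intro u v k hk
    obtain ⟨j, rfl⟩ : ∃ j, k = j + 1 := ⟨k - 1, by omega⟩
    simp [wordPow, List.replicate_succ, List.append_assoc]
  cases n with
  | zero => exact key _ _ _ (hd 0)
  | succ n => exact key _ _ _ (hd (n + 1))

theorem lt_length_standardWord {d : ℕ → ℕ} (hd : ∀ i, 1 ≤ d i) :
    ∀ n, n < (standardWord d n).length
  | 0 => by simp [standardWord]
  | 1 => by
    have := hd 0
    simp [standardWord, wordPow]
    omega
  | n + 2 => by
    have h0 := lt_length_standardWord hd n
    have h1 := lt_length_standardWord hd (n + 1)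
    have h2 := Nat.mul_le_mul_right (standardWord d (n + 1)).length (hd (n + 1))
    simp [standardWord, wordPow]
    omega

/-- Every standard word `s_n` is a prefix of the characteristic word, which is therefore the limit
of the `s_n`. -/
theorem factor_characteristicWord {d : ℕ → ℕ} (hd : ∀ i, 1 ≤ d i) (n : ℕ) :
    factor (characteristicWord d) 0 (standardWord d n).length = standardWord d n := by
  have mono : ∀ i j, standardWord d i <+: standardWord d (i + j) := by
    intro i j
    induction j with
    | zero => exact List.prefix_refl _
    | succ j ih => exact ih.trans (standardWord_prefix_succ hd (i + j))
  apply List.ext_getElem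
  · simp [factor]
  · intro i h₁ h₂
    have hi := lt_length_standardWord hd i
    simp only [factor, List.getElem_map, List.getElem_range', characteristicWord]
    rw [show 0 + 1 * i = i by omega, List.getD_eq_getElem _ _ hi]
    rcases le_total i n with h | h
    · obtain ⟨j, rfl⟩ := Nat.exists_eq_add_of_le h
      exact (mono i j).getElem hi
    · obtain ⟨j, rfl⟩ := Nat.exists_eq_add_of_le h
      exact ((mono n j).getElem h₂).symm

/-!
The proof desubstitutes. Let `φ` be the morphism `a ↦ a ^ (d 0) b`, `b ↦ a`, and let `w'` be the
characteristic word of the shifted directive sequence `d' i = d (i + 1)`. Then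
`s_{n+1}(d) = φ(s_n(d'))`, so `w = φ(w')`. With `f P = |φ(w'(0..P])|` (`imageLength`), a valid
representation of `P` for `d'` becomes, after appending a last digit `x`, a valid representation of
`f P + x` for `d` as soon as the prefix `w(0..f P]` is followed by `a ^ x`
(`representationWord_cons`, `factor_zero_imageLength_add`).

As `w'` has no factor `bb`, for every `P` the prefix `w(0..f P]` is followed by `a ^ (d 0)`, and the
next letter is `b` exactly when `w'[P + 1] = a`.

Given a palindrome `w(p₁..p₂]`, write `p₁ = f P + x` with `P` maximal, so `x ≤ d 0`. If the
palindrome lies inside the run of `a`s that follows `w(0..f P]`, then `p₁` and `p₂` differ in the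
last digit only, and `m = 0`. Otherwise the reflection of the first `b` of the palindrome shows that
`p₂ = f Q + (d 0 - x)` for some `Q` (`exists_imageLength_eq_of_reflection`), and comparing the `b`s
from the two ends inwards shows that `w'(P..Q]` is a palindrome
(`reflection_of_imageLength`). As `Q < p₂`, strong induction on `p₂` applies to `w'(P..Q]`, and
appending the digits `x` and `d 0 - x` to the representations of `P` and `Q` finishes the proof.
-/

/-! ### Prefixes of infinite words -/

theorem length_factor (w : ℕ → Letter) (i j : ℕ) : (factor w i j).length = j - i := by
  simp [factor]

theorem factor_zero_add (w : ℕ → Letter) (m n : ℕ) :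
    factor w 0 (m + n) = factor w 0 m ++ (List.range n).map fun j => w (m + j) := by
  simp only [factor, Nat.sub_zero, ← List.range_eq_range', List.range_add, List.map_append,
    List.map_map]
  rfl

theorem factor_zero_succ (w : ℕ → Letter) (n : ℕ) :
    factor w 0 (n + 1) = factor w 0 n ++ [w n] := by
  simp [factor_zero_add w n 1]

theorem factor_zero_prefix (w : ℕ → Letter) {m n : ℕ} (h : m ≤ n) :
    factor w 0 m <+: factor w 0 n := by
  obtain ⟨k, rfl⟩ := Nat.exists_eq_add_of_le h
  exact ⟨_, (factor_zero_add w m k).symm⟩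

theorem factor_palindrome_iff (w : ℕ → Letter) (p q : ℕ) :
    (factor w p q).Palindrome ↔ ∀ s t, p ≤ s → p ≤ t → s + t + 1 = p + q → w s = w t := by
  constructor
  · intro h s t hs ht hst
    have hrev := h.reverse_eq
    have h1 : s - p < (factor w p q).reverse.length := by
      rw [List.length_reverse, length_factor]; omega
    have h2 : s - p < (factor w p q).length := by rw [length_factor]; omega
    have h3 : (factor w p q).reverse[s - p] = (factor w p q)[s - p] := by
      simp only [hrev]
    rw [List.getElem_reverse] at h3
    simp only [factor, List.getElem_map, List.getElem_range', List.length_map,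
      List.length_range'] at h3
    rw [show s = p + 1 * (s - p) by omega, show t = p + 1 * (q - p - 1 - (s - p)) by omega]
    exact h3.symm
  · intro h
    refine List.Palindrome.of_reverse_eq (List.ext_getElem (by simp) ?_)
    intro i h1 h2
    rw [length_factor] at h2
    rw [List.getElem_reverse]
    simp only [factor, List.getElem_map, List.getElem_range', List.length_map, List.length_range']
    exact h _ _ (by omega) (by omega) (by omega)

/-! ### The morphism and the shifted directive sequence -/

/-- The image of a letter under the morphism `a ↦ a ^ k b`, `b ↦ a`. -/
def letterImage (k : ℕ) : Letter → List Letter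
  | Letter.a => List.replicate k Letter.a ++ [Letter.b]
  | Letter.b => [Letter.a]

/-- The image of a finite word under the morphism `a ↦ a ^ k b`, `b ↦ a`. -/
def wordImage (k : ℕ) (u : List Letter) : List Letter :=
  u.flatMap (letterImage k)

/-- The directive sequence with its first term removed. -/
def shift (d : ℕ → ℕ) (i : ℕ) : ℕ := d (i + 1)

/-- The sequence of digits `k` with a new last digit `x`; digit `0` is the last one. -/
def consDigit (x : ℕ) (k : ℕ → ℕ) : ℕ → ℕ
  | 0 => x
  | i + 1 => k i

theorem wordPow_singleton (c : Letter) (k : ℕ) : wordPow [c] k = List.replicate k c := by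
  simp [wordPow]

theorem wordImage_append (k : ℕ) (u v : List Letter) :
    wordImage k (u ++ v) = wordImage k u ++ wordImage k v := by
  simp [wordImage]

theorem wordImage_wordPow (k : ℕ) (u : List Letter) (j : ℕ) :
    wordImage k (wordPow u j) = wordPow (wordImage k u) j := by
  induction j with
  | zero => simp [wordPow, wordImage]
  | succ j ih =>
    simp only [wordPow, List.replicate_succ, List.flatten_cons, wordImage_append] at ih ⊢
    rw [ih]

theorem standardWord_succ_eq_wordImage (d : ℕ → ℕ) :
    ∀ n, standardWord d (n + 1) = wordImage (d 0) (standardWord (shift d) n)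
  | 0 => by simp [standardWord, wordImage, letterImage, wordPow_singleton]
  | 1 => by
    change wordPow (standardWord d 1) (d 1) ++ standardWord d 0 =
      wordImage (d 0) (wordPow (standardWord (shift d) 0) (shift d 0) ++ [Letter.b])
    rw [standardWord_succ_eq_wordImage d 0, wordImage_append, wordImage_wordPow]
    simp [standardWord, shift, wordImage, letterImage]
  | n + 2 => by
    rw [standardWord, standardWord_succ_eq_wordImage d (n + 1),
      standardWord_succ_eq_wordImage d n, standardWord, wordImage_append, wordImage_wordPow]
    rfl

theorem representationWord_cons (d k : ℕ → ℕ) (x : ℕ) : ∀ n,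
    representationWord d (consDigit x k) (n + 1) =
      wordImage (d 0) (representationWord (shift d) k n) ++ List.replicate x Letter.a
  | 0 => by
    rw [representationWord, representationWord, representationWord, wordImage_wordPow,
      standardWord_succ_eq_wordImage, ← wordPow_singleton]
    rfl
  | n + 1 => by
    rw [representationWord, representationWord_cons d k x n, standardWord_succ_eq_wordImage,
      representationWord, wordImage_append, wordImage_wordPow, List.append_assoc]
    rfl

theorem length_representationWord (d k : ℕ → ℕ) (n : ℕ) :
    (representationWord d k n).length =
      ∑ i ∈ Finset.range (n + 1), k i * (standardWord d i).length := by
  induction n with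
  | zero => simp [representationWord, wordPow]
  | succ n ih =>
    rw [Finset.sum_range_succ, ← ih, representationWord]
    simp [wordPow, add_comm]

/-- In a valid representation the value of `N` is determined by the equality of words. -/
theorem isValidRepresentation_of_prefix_eq {d k : ℕ → ℕ} {N n : ℕ}
    (h : factor (characteristicWord d) 0 N = representationWord d k n) :
    IsValidRepresentation d N n k :=
  ⟨by rw [← length_representationWord, ← h, length_factor, Nat.sub_zero], h⟩

/-! ### Desubstitution of the characteristic word -/

/-- The length of the image of the prefix of length `P` of the characteristic word of `shift d`;
this image is a prefix of the characteristic word of `d`. -/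
def imageLength (d : ℕ → ℕ) (P : ℕ) : ℕ :=
  (wordImage (d 0) (factor (characteristicWord (shift d)) 0 P)).length

theorem one_le_shift {d : ℕ → ℕ} (hd : ∀ i, 1 ≤ d i) (i : ℕ) : 1 ≤ shift d i := hd _

theorem factor_zero_imageLength {d : ℕ → ℕ} (hd : ∀ i, 1 ≤ d i) (P : ℕ) :
    factor (characteristicWord d) 0 (imageLength d P) =
      wordImage (d 0) (factor (characteristicWord (shift d)) 0 P) := by
  have h1 := factor_zero_prefix (characteristicWord (shift d))
    (lt_length_standardWord (one_le_shift hd) P).le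
  rw [factor_characteristicWord (one_le_shift hd)] at h1
  have h2 : wordImage (d 0) (factor (characteristicWord (shift d)) 0 P) <+:
      factor (characteristicWord d) 0 (standardWord d (P + 1)).length := by
    rw [factor_characteristicWord hd, standardWord_succ_eq_wordImage]
    obtain ⟨v, hv⟩ := h1
    exact ⟨wordImage (d 0) v, by rw [← hv, wordImage_append]⟩
  have hlen : imageLength d P ≤ (standardWord d (P + 1)).length := by
    simpa [length_factor, imageLength] using h2.length_le
  refine (List.prefix_of_prefix_length_le (factor_zero_prefix _ hlen) h2 ?_).eq_of_length ?_ <;>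
    simp [length_factor, imageLength]

theorem factor_zero_imageLength_add {d : ℕ → ℕ} (hd : ∀ i, 1 ≤ d i) {P x : ℕ}
    (h : ∀ j < x, characteristicWord d (imageLength d P + j) = Letter.a) :
    factor (characteristicWord d) 0 (imageLength d P + x) =
      wordImage (d 0) (factor (characteristicWord (shift d)) 0 P) ++
        List.replicate x Letter.a := by
  rw [factor_zero_add, factor_zero_imageLength hd]
  congr 1
  refine List.eq_replicate_iff.mpr ⟨by simp, ?_⟩
  simp only [List.mem_map, List.mem_range]
  rintro _ ⟨j, hj, rfl⟩
  exact h j hj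

theorem imageLength_zero (d : ℕ → ℕ) : imageLength d 0 = 0 := by
  simp [imageLength, factor, wordImage]

theorem imageLength_succ (d : ℕ → ℕ) (P : ℕ) :
    imageLength d (P + 1) =
      imageLength d P + (letterImage (d 0) (characteristicWord (shift d) P)).length := by
  simp [imageLength, factor_zero_succ, wordImage]

theorem imageLength_succ_of_a {d : ℕ → ℕ} {P : ℕ}
    (h : characteristicWord (shift d) P = Letter.a) :
    imageLength d (P + 1) = imageLength d P + d 0 + 1 := by
  simp [imageLength_succ, h, letterImage, add_assoc]

theorem imageLength_succ_of_b {d : ℕ → ℕ} {P : ℕ}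
    (h : characteristicWord (shift d) P = Letter.b) :
    imageLength d (P + 1) = imageLength d P + 1 := by
  simp [imageLength_succ, h, letterImage]

theorem imageLength_strictMono (d : ℕ → ℕ) : StrictMono (imageLength d) := by
  refine strictMono_nat_of_lt_succ fun P => ?_
  cases h : characteristicWord (shift d) P
  · rw [imageLength_succ_of_a h]; omega
  · rw [imageLength_succ_of_b h]; omega

theorem map_range_characteristicWord {d : ℕ → ℕ} (hd : ∀ i, 1 ≤ d i) (P : ℕ) :
    ((List.range (letterImage (d 0) (characteristicWord (shift d) P)).length).map
      fun j => characteristicWord d (imageLength d P + j)) =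
      letterImage (d 0) (characteristicWord (shift d) P) := by
  have h := factor_zero_imageLength hd (P + 1)
  rw [imageLength_succ, factor_zero_add, factor_zero_imageLength hd, factor_zero_succ,
    wordImage_append] at h
  simpa [wordImage] using List.append_cancel_left h

theorem characteristicWord_imageLength_add {d : ℕ → ℕ} (hd : ∀ i, 1 ≤ d i) {P j : ℕ}
    (hj : j < (letterImage (d 0) (characteristicWord (shift d) P)).length) :
    characteristicWord d (imageLength d P + j) =
      (letterImage (d 0) (characteristicWord (shift d) P))[j] := by
  have h := List.getElem_of_eq (map_range_characteristicWord hd P) (i := j) (by simpa using hj)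
  simpa using h

theorem characteristicWord_zero (d : ℕ → ℕ) : characteristicWord d 0 = Letter.a := by
  simp [characteristicWord, standardWord]

theorem characteristicWord_imageLength {d : ℕ → ℕ} (hd : ∀ i, 1 ≤ d i) (P : ℕ) :
    characteristicWord d (imageLength d P) = Letter.a := by
  have h := @characteristicWord_imageLength_add d hd P 0
  have := hd 0
  cases hP : characteristicWord (shift d) P <;> simp only [hP] at h
  · simpa [letterImage, List.getElem_append, show 0 < d 0 by omega] using h
  · simpa [letterImage] using h

theorem characteristicWord_eq_a_of_a {d : ℕ → ℕ} (hd : ∀ i, 1 ≤ d i) {P j : ℕ}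
    (h : characteristicWord (shift d) P = Letter.a) (hj : j < d 0) :
    characteristicWord d (imageLength d P + j) = Letter.a := by
  rw [characteristicWord_imageLength_add hd (by simp [h, letterImage]; omega)]
  simp [h, letterImage, hj]

theorem characteristicWord_eq_b_of_a {d : ℕ → ℕ} (hd : ∀ i, 1 ≤ d i) {P : ℕ}
    (h : characteristicWord (shift d) P = Letter.a) :
    characteristicWord d (imageLength d P + d 0) = Letter.b := by
  rw [characteristicWord_imageLength_add hd (by simp [h, letterImage])]
  simp [h, letterImage]

/-- Every position lies in the image of a unique letter. The digit `x` is at most `d 0`, and it is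
`0` when that letter is `b`. -/
theorem exists_eq_imageLength_add (d : ℕ → ℕ) (p : ℕ) :
    ∃ P x, p = imageLength d P + x ∧ x ≤ d 0 ∧
      (characteristicWord (shift d) P = Letter.b → x = 0) := by
  induction p with
  | zero => exact ⟨0, 0, by simp [imageLength_zero], by omega, fun _ => rfl⟩
  | succ p ih =>
    obtain ⟨P, x, rfl, hx, hb⟩ := ih
    cases hP : characteristicWord (shift d) P with
    | a =>
      rcases hx.lt_or_eq with hlt | rfl
      · exact ⟨P, x + 1, by omega, by omega, by simp [hP]⟩
      · exact ⟨P + 1, 0, by rw [imageLength_succ_of_a hP, add_zero], by omega, fun _ => rfl⟩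
    | b =>
      exact ⟨P + 1, 0, by rw [imageLength_succ_of_b hP, hb hP], by omega, fun _ => rfl⟩

theorem exists_imageLength_eq_of_b {d : ℕ → ℕ} (hd : ∀ i, 1 ≤ d i) {p : ℕ}
    (h : characteristicWord d p = Letter.b) : ∃ P, imageLength d P = p + 1 := by
  obtain ⟨P, x, rfl, hx, hb⟩ := exists_eq_imageLength_add d p
  cases hP : characteristicWord (shift d) P with
  | a =>
    rcases hx.lt_or_eq with hlt | rfl
    · simp [characteristicWord_eq_a_of_a hd hP hlt] at h
    · exact ⟨P + 1, imageLength_succ_of_a hP⟩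
  | b => simp [hb hP, characteristicWord_imageLength hd P] at h

/-- The characteristic word has no factor `bb`. -/
theorem characteristicWord_succ_of_b {d : ℕ → ℕ} (hd : ∀ i, 1 ≤ d i) {p : ℕ}
    (h : characteristicWord d p = Letter.b) : characteristicWord d (p + 1) = Letter.a := by
  obtain ⟨P, hP⟩ := exists_imageLength_eq_of_b hd h
  rw [← hP]
  exact characteristicWord_imageLength hd P

theorem characteristicWord_eq_a_of_b {d : ℕ → ℕ} (hd : ∀ i, 1 ≤ d i) {P j : ℕ}
    (h : characteristicWord (shift d) P = Letter.b) (hj : j ≤ d 0) :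
    characteristicWord d (imageLength d P + j) = Letter.a := by
  cases j with
  | zero => exact characteristicWord_imageLength hd P
  | succ j =>
    rw [show imageLength d P + (j + 1) = imageLength d (P + 1) + j by
      rw [imageLength_succ_of_b h]; omega]
    exact characteristicWord_eq_a_of_a hd
      (characteristicWord_succ_of_b (one_le_shift hd) h) (by omega)

theorem characteristicWord_eq_a {d : ℕ → ℕ} (hd : ∀ i, 1 ≤ d i) {P j : ℕ} (hj : j < d 0) :
    characteristicWord d (imageLength d P + j) = Letter.a := by
  cases hP : characteristicWord (shift d) P with
  | a => exact characteristicWord_eq_a_of_a hd hP hj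
  | b => exact characteristicWord_eq_a_of_b hd hP hj.le

theorem lt_imageLength {d : ℕ → ℕ} (hd : ∀ i, 1 ≤ d i) {P : ℕ} (hP : 0 < P) :
    P < imageLength d P := by
  induction P with
  | zero => omega
  | succ P ih =>
    rcases P.eq_zero_or_pos with rfl | h
    · have := hd 0
      rw [imageLength_succ_of_a (characteristicWord_zero _)]
      omega
    · have := ih h
      have := imageLength_strictMono d P.lt_succ_self
      simp only [Nat.succ_eq_add_one] at this
      omega

/-! ### Extending representations by a digit -/

theorem IsValidRepresentation.cons {d : ℕ → ℕ} (hd : ∀ i, 1 ≤ d i) {P n x : ℕ} {k : ℕ → ℕ}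
    (hk : IsValidRepresentation (shift d) P n k)
    (h : ∀ j < x, characteristicWord d (imageLength d P + j) = Letter.a) :
    IsValidRepresentation d (imageLength d P + x) (n + 1) (consDigit x k) :=
  isValidRepresentation_of_prefix_eq (by
    rw [representationWord_cons, factor_zero_imageLength_add hd h, hk.prefix_eq])

theorem isValidRepresentation_zero (d : ℕ → ℕ) : IsValidRepresentation d 0 0 fun _ => 0 :=
  isValidRepresentation_of_prefix_eq (by simp [factor, representationWord, wordPow])

theorem exists_isValidRepresentation {d : ℕ → ℕ} (hd : ∀ i, 1 ≤ d i) (N : ℕ) :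
    ∃ n k, IsValidRepresentation d N n k := by
  induction N using Nat.strong_induction_on generalizing d with
  | _ N ih =>
    obtain ⟨P, x, rfl, hx, hb⟩ := exists_eq_imageLength_add d N
    have hP : ∃ n k, IsValidRepresentation (shift d) P n k := by
      rcases P.eq_zero_or_pos with rfl | hpos
      · exact ⟨_, _, isValidRepresentation_zero _⟩
      · exact ih P (by have := lt_imageLength hd hpos; omega) (one_le_shift hd)
    obtain ⟨n, k, hk⟩ := hP
    exact ⟨_, _, hk.cons hd fun j hj => characteristicWord_eq_a hd (by omega)⟩

/-! ### Desubstitution of palindromes -/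

/-- A palindrome `w(p..q]` with `p = f P + x` reaching beyond the run of `a`s that follows
`w(0..f P]` ends at `f Q + (d 0 - x)`. The reason is that the first `b` of the palindrome is
reflected to another `b`, which ends the image of a letter. -/
theorem exists_imageLength_eq_of_reflection {d : ℕ → ℕ} (hd : ∀ i, 1 ≤ d i) {p q P x j : ℕ}
    (hpal : ∀ s t, p ≤ s → p ≤ t → s + t + 1 = p + q →
      characteristicWord d s = characteristicWord d t)
    (hp : p = imageLength d P + x) (hx : x ≤ d 0)
    (hb : characteristicWord (shift d) P = Letter.b → x = 0)
    (hj : imageLength d P + j < q) (hja : characteristicWord d (imageLength d P + j) ≠ Letter.a) :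
    ∃ Q, P ≤ Q ∧ imageLength d Q + (d 0 - x) = q := by
  have mono := imageLength_strictMono d
  cases hP : characteristicWord (shift d) P with
  | a =>
    have hj' : d 0 ≤ j := by
      by_contra hlt
      exact hja (characteristicWord_eq_a hd (by omega))
    have h := hpal (imageLength d P + d 0) (p + q - 1 - (imageLength d P + d 0))
      (by omega) (by omega) (by omega)
    rw [characteristicWord_eq_b_of_a hd hP] at h
    obtain ⟨Q, hQ⟩ := exists_imageLength_eq_of_b hd h.symm
    exact ⟨Q, mono.le_iff_le.mp (by omega), by omega⟩
  | b =>
    obtain rfl := hb hP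
    have hj' : d 0 < j := by
      by_contra hle
      exact hja (characteristicWord_eq_a_of_b hd hP (by omega))
    have hP1 := imageLength_succ_of_b hP
    have h := hpal (imageLength d (P + 1) + d 0) (q - 2 - d 0)
      (by omega) (by omega) (by omega)
    rw [characteristicWord_eq_b_of_a hd (characteristicWord_succ_of_b (one_le_shift hd) hP)] at h
    obtain ⟨Q, hQ⟩ := exists_imageLength_eq_of_b hd h.symm
    cases hQl : characteristicWord (shift d) Q with
    | a =>
      -- The last letter of the palindrome would be `b`, although its first letter is `a`.
      have h' := hpal (imageLength d P) (imageLength d Q + d 0) (by omega) (by omega) (by omega)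
      rw [characteristicWord_eq_b_of_a hd hQl, characteristicWord_imageLength hd] at h'
      simp at h'
    | b =>
      have := imageLength_succ_of_b hQl
      exact ⟨Q + 1, mono.le_iff_le.mp (by omega), by omega⟩

/-- Let `w(p..q]` be a palindrome with `p = f P + x` and `q = f Q + (d 0 - x)`. If the run of `a`s
of length `d 0` after `w(0..f S]` is mirrored to the one after `w(0..f (R + 1)]`, then
`w'[S + 1] = w'[R + 1]`: if one of these letters is `a`, the `b` that ends its image is reflected
to a position which holds `b` only if the other letter is `a` too. -/
theorem characteristicWord_shift_eq_of_reflection {d : ℕ → ℕ} (hd : ∀ i, 1 ≤ d i)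
    {p q P Q x S R : ℕ}
    (hpal : ∀ s t, p ≤ s → p ≤ t → s + t + 1 = p + q →
      characteristicWord d s = characteristicWord d t)
    (hp : p = imageLength d P + x) (hx : x ≤ d 0) (hq : imageLength d Q + (d 0 - x) = q)
    (hS : P ≤ S) (hSQ : S < Q) (hR : P ≤ R)
    (hsum : imageLength d S + imageLength d (R + 1) + d 0 = p + q) :
    characteristicWord (shift d) S = characteristicWord (shift d) R := by
  have mono := (imageLength_strictMono d).monotone
  have h1 := mono hS
  have h2 := mono hR
  have h3 := mono (Nat.succ_le_of_lt hSQ)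
  simp only [Nat.succ_eq_add_one] at h3
  cases hSl : characteristicWord (shift d) S <;> cases hRl : characteristicWord (shift d) R
  · rfl
  · rw [imageLength_succ_of_a hSl] at h3
    rw [imageLength_succ_of_b hRl] at hsum
    have h := hpal (imageLength d S + d 0) (imageLength d R) (by omega) (by omega) (by omega)
    rw [characteristicWord_eq_b_of_a hd hSl, characteristicWord_imageLength hd] at h
    simp at h
  · rw [imageLength_succ_of_a hRl] at hsum
    have h := hpal (imageLength d S + d 0) (imageLength d R + d 0)
      (by omega) (by omega) (by omega)
    rw [characteristicWord_eq_a_of_b hd hSl le_rfl, characteristicWord_eq_b_of_a hd hRl] at h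
    simp at h
  · rfl

/-- If `w(p..q]` is a palindrome with `p = f P + x` and `q = f Q + (d 0 - x)`, then `w'(P..Q]` is a
palindrome. -/
theorem reflection_of_imageLength {d : ℕ → ℕ} (hd : ∀ i, 1 ≤ d i) {p q P Q x : ℕ}
    (hpal : ∀ s t, p ≤ s → p ≤ t → s + t + 1 = p + q →
      characteristicWord d s = characteristicWord d t)
    (hp : p = imageLength d P + x) (hx : x ≤ d 0) (hq : imageLength d Q + (d 0 - x) = q) :
    ∀ s t, P ≤ s → P ≤ t → s + t + 1 = P + Q →
      characteristicWord (shift d) s = characteristicWord (shift d) t := by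
  have sum_eq : ∀ k R, R + k = Q → P ≤ R →
      imageLength d (P + k) + imageLength d R + d 0 = p + q := by
    intro k
    induction k with
    | zero =>
      rintro R rfl -
      simp only [add_zero] at *
      omega
    | succ k ih =>
      intro R hRk hR
      have h := ih (R + 1) (by omega) (by omega)
      have heq := characteristicWord_shift_eq_of_reflection hd hpal hp hx hq
        (Nat.le_add_right P k) (by omega) hR h
      rw [← add_assoc]
      cases hRl : characteristicWord (shift d) R with
      | a =>
        rw [imageLength_succ_of_a hRl] at h
        rw [imageLength_succ_of_a (heq.trans hRl)]
        omega
      | b =>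
        rw [imageLength_succ_of_b hRl] at h
        rw [imageLength_succ_of_b (heq.trans hRl)]
        omega
  intro s t hs ht hst
  refine characteristicWord_shift_eq_of_reflection hd hpal hp hx hq hs (by omega) ht ?_
  have h := sum_eq (s - P) (t + 1) (by omega) (by omega)
  rwa [show P + (s - P) = s by omega] at h

theorem theorem4 (d : ℕ → ℕ) (hd : ∀ i, 1 ≤ d i) (p₁ p₂ : ℕ) (hp : p₁ ≤ p₂)
    (hpal : (factor (characteristicWord d) p₁ p₂).Palindrome) :
    ∃ (n : ℕ) (x : ℕ → ℕ) (m : ℕ) (y : ℕ),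
      IsValidRepresentation d p₁ n x ∧
      m ≤ n ∧
      (∀ i, i < m → x i ≤ d i) ∧
      IsValidRepresentation d p₂ n
        (fun i => if i < m then d i - x i else if i = m then y else x i) := by
  induction p₂ using Nat.strong_induction_on generalizing d p₁ with
  | _ p₂ ih =>
    have hrefl := (factor_palindrome_iff _ _ _).mp hpal
    obtain ⟨P, x, hPx, hx, hb⟩ := exists_eq_imageLength_add d p₁
    have hxa : ∀ j < x, characteristicWord d (imageLength d P + j) = Letter.a :=
      fun j hj => characteristicWord_eq_a hd (by omega)
    by_cases hrun : ∀ j < p₂ - imageLength d P,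
        characteristicWord d (imageLength d P + j) = Letter.a
    · obtain ⟨n, k, hk⟩ := exists_isValidRepresentation (one_le_shift hd) P
      have h₂ := hk.cons hd hrun
      rw [show imageLength d P + (p₂ - imageLength d P) = p₂ by omega] at h₂
      refine ⟨n + 1, consDigit x k, 0, p₂ - imageLength d P, hPx ▸ hk.cons hd hxa,
        by omega, by omega, ?_⟩
      convert h₂ using 2 with i
      cases i <;> simp [consDigit]
    · push Not at hrun
      obtain ⟨j, hj, hja⟩ := hrun
      obtain ⟨Q, hPQ, hQ⟩ :=
        exists_imageLength_eq_of_reflection hd hrefl hPx hx hb (j := j) (by omega) hja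
      have hQlt : Q < p₂ := by
        rcases Q.eq_zero_or_pos with rfl | hpos
        · omega
        · have := lt_imageLength hd hpos
          omega
      obtain ⟨n, k, m, y, h₁, hm, hk, h₂⟩ := ih Q hQlt (shift d) (one_le_shift hd) P hPQ
        ((factor_palindrome_iff _ _ _).mpr (reflection_of_imageLength hd hrefl hPx hx hQ))
      have h₂' := h₂.cons hd (x := d 0 - x) fun j hj => characteristicWord_eq_a hd (by omega)
      rw [hQ] at h₂'
      refine ⟨n + 1, consDigit x k, m + 1, y, hPx ▸ h₁.cons hd hxa, by omega, ?_, ?_⟩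
      · rintro (_ | i) hi
        · exact hx
        · exact hk i (by omega)
      · convert h₂' using 2 with i
        cases i <;> simp [consDigit, shift]
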